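/- For probability measures $P,Q$ on $\mathbb{R}^d$ let $\mathrm{TV}(P,Q)=\sup_{A}|P(A)-Q(A)|$, the supremum being over all measurable sets $A\subseteq\mathbb{R}^d$, and let $\mathcal N(\mu,\Sigma)$ denote the (possibly degenerate) Gaussian distribution on $\mathbb{R}^d$ with mean $\mu$ and covariance matrix $\Sigma$. Let $\mu\in\mathbb{R}^d$. (1) Let $\Sigma_1,\Sigma_2$ be positive definite (real symmetric) $d\times d$ matrices. Then all eigenvalues of $\Sigma_1^{-1}\Sigma_2-I_d$ are real and, if $\lambda_1,\dots,\lambda_d$ denotes the list of these eigenvalues counted with multiplicity, then \[ \frac1{100}\min\Big\{1,\sqrt{\textstyle\sum_{i=1}^d\lambda_i^2}\Big\}\;\le\;\mathrm{TV}\big(\mathcal N(\mu,\Sigma_1),\mathcal N(\mu,\Sigma_2)\big)\;\le\;\frac32\min\Big\{1,\sqrt{\textstyle\sum_{i=1}^d\lambda_i^2}\Big\}. \] (2) Let $\Sigma_1,\Sigma_2$ be positive semidefinite (real symmetric) $d\times d$ matrices with $\operatorname{range}(\Sigma_1)=\operatorname{range}(\Sigma_2)$, let $r=\operatorname{rank}(\Sigma_1)=\operatorname{rank}(\Sigma_2)$,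 and let $\Pi$ be any real $d\times r$ matrix with $\operatorname{range}(\Pi)=\operatorname{range}(\Sigma_1)$. Then $\Pi^{\mathsf T}\Sigma_1\Pi$ is invertible, all eigenvalues of $(\Pi^{\mathsf T}\Sigma_1\Pi)^{-1}(\Pi^{\mathsf T}\Sigma_2\Pi)-I_r$ are real and, if $\rho_1,\dots,\rho_r$ denotes the list of these eigenvalues counted with multiplicity, then \[ \frac1{100}\min\Big\{1,\sqrt{\textstyle\sum_{i=1}^r\rho_i^2}\Big\}\;\le\;\mathrm{TV}\big(\mathcal N(\mu,\Sigma_1),\mathcal N(\mu,\Sigma_2)\big)\;\le\;\frac32\min\Big\{1,\sqrt{\textstyle\sum_{i=1}^r\rho_i^2}\Big\}. \] -/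

import Mathlib

/-- The total variation distance `sup_A |P(A) - Q(A)|` between two probability measures, the
supremum being over all measurable sets `A`. -/
noncomputable def tvDist {Ω : Type*} [MeasurableSpace Ω] (P Q : MeasureTheory.Measure Ω) : ℝ :=
  ⨆ A : {A : Set Ω // MeasurableSet A}, |P.real A.1 - Q.real A.1|

/-- `l 0, …, l (n - 1)` is the list of the (real) eigenvalues of the `n × n` matrix `A`, counted
with multiplicity: the characteristic polynomial of `A` is the product of the `X - l i`. -/
def IsEigenvalueList {n : ℕ} (A : Matrix (Fin n) (Fin n) ℝ) (l : Fin n → ℝ) : Prop :=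
  A.charpoly = ∏ i, (Polynomial.X - Polynomial.C (l i))

/-! Total variation does not increase under measurable maps, so a pair of Gaussians may be carried
back and forth by affine maps. On the common range of the covariances, simultaneous diagonalization
sends the pair to `N(0, I)` and `N(0, diag v)`, with `v i - 1` the eigenvalues in question.
Everything is then a statement about product measures and `s = ∑ (v i - 1)²`.

Upper bound: TV is at most the square root of the χ²-divergence, which for these products is `∏ (1 -
(v i - 1)²)^(-1/2) - 1`, of order `s` for small `s`. For large `s` the bound `TV ≤ 1` suffices
(`tvDist_pi_gaussianReal_le`).

Lower bound: TV controls differences of integrals of functions bounded by 1. The test function is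
`exp(i t ∑ (v i - 1) x i²)`, whose integrals are explicit. Their phases differ by an amount
comparable to `t s`, because every coordinate contributes with the same sign
(`le_tvDist_pi_gaussianReal_of_scale`). The scale `t` is then optimized. -/

section

open MeasureTheory ProbabilityTheory
open scoped NNReal

/-! ### Total variation: test functions, pushforwards, χ²-divergence -/

section TotalVariation

variable {Ω Ω' : Type*} [MeasurableSpace Ω] [MeasurableSpace Ω'] (P Q : Measure Ω)
  [IsProbabilityMeasure P] [IsProbabilityMeasure Q]

theorem abs_measureReal_sub_le_one (A : Set Ω) : |P.real A - Q.real A| ≤ 1 := by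
  have h1 : P.real A ≤ 1 := measureReal_le_one
  have h2 : Q.real A ≤ 1 := measureReal_le_one
  have h3 : 0 ≤ P.real A := measureReal_nonneg
  have h4 : 0 ≤ Q.real A := measureReal_nonneg
  rw [abs_le]
  constructor <;> linarith

theorem abs_measureReal_sub_le_tvDist {A : Set Ω} (hA : MeasurableSet A) :
    |P.real A - Q.real A| ≤ tvDist P Q :=
  le_ciSup (f := fun A : {A : Set Ω // MeasurableSet A} => |P.real A.1 - Q.real A.1|)
    ⟨1, by rintro _ ⟨A, rfl⟩; exact abs_measureReal_sub_le_one P Q A.1⟩ ⟨A, hA⟩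

theorem tvDist_le_of_forall {Ω : Type*} [MeasurableSpace Ω] (P Q : Measure Ω) {c : ℝ}
    (h : ∀ A, MeasurableSet A → |P.real A - Q.real A| ≤ c) : tvDist P Q ≤ c :=
  have : Nonempty {A : Set Ω // MeasurableSet A} := ⟨⟨∅, MeasurableSet.empty⟩⟩
  ciSup_le fun A => h A.1 A.2

theorem tvDist_nonneg : 0 ≤ tvDist P Q :=
  (abs_nonneg _).trans (abs_measureReal_sub_le_tvDist P Q MeasurableSet.empty)

theorem tvDist_le_one : tvDist P Q ≤ 1 :=
  tvDist_le_of_forall P Q fun A _ => abs_measureReal_sub_le_one P Q A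

theorem tvDist_map_le {f : Ω → Ω'} (hf : Measurable f) :
    tvDist (P.map f) (Q.map f) ≤ tvDist P Q := by
  refine tvDist_le_of_forall _ _ fun A hA => ?_
  rw [map_measureReal_apply hf hA, map_measureReal_apply hf hA]
  exact abs_measureReal_sub_le_tvDist P Q (hf hA)

theorem integral_eq_integral_Ioc_measureReal_lt {f : Ω → ℝ} (hf : Measurable f)
    (h0 : ∀ x, 0 ≤ f x) (h1 : ∀ x, f x ≤ 1) :
    ∫ x, f x ∂P = ∫ t in Set.Ioc (0 : ℝ) 1, P.real {x | t < f x} := by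
  have hint : Integrable f P :=
    Integrable.of_bound hf.aestronglyMeasurable 1 (ae_of_all _ fun x => by
      rw [Real.norm_eq_abs, abs_of_nonneg (h0 x)]; exact h1 x)
  rw [hint.integral_eq_integral_meas_lt (ae_of_all _ h0)]
  refine (setIntegral_eq_of_subset_of_forall_sdiff_eq_zero measurableSet_Ioi
    Set.Ioc_subset_Ioi_self fun t ht => ?_)
  have : {x | t < f x} = ∅ := by
    ext x
    simp only [Set.mem_ofPred_eq, Set.mem_empty_iff_false, iff_false, not_lt]
    have : 1 < t := by
      by_contra h
      exact ht.2 ⟨ht.1, not_lt.1 h⟩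
    linarith [h1 x]
  simp [this]

theorem integrableOn_measureReal_lt (f : Ω → ℝ) :
    IntegrableOn (fun t => P.real {x | t < f x}) (Set.Ioc (0 : ℝ) 1) := by
  have hanti : Antitone fun t : ℝ => P.real {x | t < f x} := fun s t hst =>
    measureReal_mono fun x (hx : t < f x) => lt_of_le_of_lt hst hx
  refine Measure.integrableOn_of_bounded (M := 1) (by simp)
    hanti.measurable.aestronglyMeasurable (ae_of_all _ fun t => ?_)
  rw [Real.norm_eq_abs, abs_of_nonneg measureReal_nonneg]
  exact measureReal_le_one

/-- By the layer-cake formula both integrals are averages over `t ∈ (0, 1]` of the measures of the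
superlevel sets `{t < f}`, and each such set is admissible in the supremum. -/
theorem abs_integral_sub_le_tvDist {f : Ω → ℝ} (hf : Measurable f)
    (h0 : ∀ x, 0 ≤ f x) (h1 : ∀ x, f x ≤ 1) :
    |∫ x, f x ∂P - ∫ x, f x ∂Q| ≤ tvDist P Q := by
  rw [integral_eq_integral_Ioc_measureReal_lt P hf h0 h1,
    integral_eq_integral_Ioc_measureReal_lt Q hf h0 h1,
    ← integral_sub (integrableOn_measureReal_lt P f) (integrableOn_measureReal_lt Q f)]
  have := norm_setIntegral_le_of_norm_le_const (μ := volume) (s := Set.Ioc (0 : ℝ) 1)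
    (f := fun t => P.real {x | t < f x} - Q.real {x | t < f x}) (C := tvDist P Q) (by simp)
    (fun t _ => by
      rw [Real.norm_eq_abs]
      exact abs_measureReal_sub_le_tvDist P Q (measurableSet_lt measurable_const hf))
  simpa using this

theorem abs_integral_sub_le_two_mul_tvDist {f : Ω → ℝ} (hf : Measurable f)
    (h : ∀ x, |f x| ≤ 1) : |∫ x, f x ∂P - ∫ x, f x ∂Q| ≤ 2 * tvDist P Q := by
  have hint (ν : Measure Ω) [IsProbabilityMeasure ν] : Integrable f ν :=
    Integrable.of_bound hf.aestronglyMeasurable 1 (ae_of_all _ h)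
  have key := abs_integral_sub_le_tvDist P Q (f := fun x => (f x + 1) / 2) (by fun_prop)
    (fun x => by linarith [(abs_le.1 (h x)).1]) (fun x => by linarith [(abs_le.1 (h x)).2])
  have e (ν : Measure Ω) [IsProbabilityMeasure ν] :
      ∫ x, (f x + 1) / 2 ∂ν = (∫ x, f x ∂ν + 1) / 2 := by
    rw [integral_div, integral_add (hint ν) (integrable_const _)]
    simp
  rw [e P, e Q, ← sub_div, abs_div, add_sub_add_right_eq_sub, abs_two] at key
  linarith

theorem norm_integral_sub_le_four_mul_tvDist {f : Ω → ℂ} (hf : Measurable f)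
    (h : ∀ x, ‖f x‖ ≤ 1) : ‖∫ x, f x ∂P - ∫ x, f x ∂Q‖ ≤ 4 * tvDist P Q := by
  have hint (ν : Measure Ω) [IsProbabilityMeasure ν] : Integrable f ν :=
    Integrable.of_bound hf.aestronglyMeasurable 1 (ae_of_all _ h)
  have hre (ν : Measure Ω) [IsProbabilityMeasure ν] :
      (∫ x, f x ∂ν).re = ∫ x, (f x).re ∂ν := (integral_re (hint ν)).symm
  have him (ν : Measure Ω) [IsProbabilityMeasure ν] :
      (∫ x, f x ∂ν).im = ∫ x, (f x).im ∂ν := (integral_im (hint ν)).symm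
  have h1 := abs_integral_sub_le_two_mul_tvDist P Q (f := fun x => (f x).re) (by fun_prop)
    fun x => (Complex.abs_re_le_norm _).trans (h x)
  have h2 := abs_integral_sub_le_two_mul_tvDist P Q (f := fun x => (f x).im) (by fun_prop)
    fun x => (Complex.abs_im_le_norm _).trans (h x)
  refine (Complex.norm_le_abs_re_add_abs_im _).trans ?_
  rw [Complex.sub_re, Complex.sub_im, hre, hre, him, him]
  linarith

/-- The total variation distance is at most the square root of the `χ²`-divergence. -/
theorem tvDist_withDensity_le_sqrt {f : Ω → ℝ} (hf : Measurable f) (h0 : ∀ x, 0 ≤ f x)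
    (hint : Integrable f P) (hone : ∫ x, f x ∂P = 1) (hsq : Integrable (fun x => f x ^ 2) P) :
    tvDist P (P.withDensity fun x => ENNReal.ofReal (f x)) ≤ √(∫ x, f x ^ 2 ∂P - 1) := by
  have hL2 : MemLp f 2 P := (memLp_two_iff_integrable_sq hf.aestronglyMeasurable).2 hsq
  have hL2' : MemLp (fun x => |1 - f x|) 2 P := ((memLp_const 1).sub hL2).norm
  -- Nonnegative variance is the Cauchy–Schwarz bound `(∫ |1 - f|)² ≤ ∫ (1 - f)²`.
  have hvar := variance_nonneg (fun x => |1 - f x|) P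
  rw [variance_eq_sub hL2'] at hvar
  have hsub : Integrable (fun x => 1 - f x) P := (integrable_const _).sub hint
  have hexp : ∫ x, ((fun x => |1 - f x|) ^ 2) x ∂P = ∫ x, f x ^ 2 ∂P - 1 := by
    have : ∀ x, ((fun x => |1 - f x|) ^ 2) x = 1 - 2 * f x + f x ^ 2 := fun x => by
      simp only [Pi.pow_apply, sq_abs]; ring
    simp_rw [this]
    have h2 : Integrable (fun x => 1 - 2 * f x) P := (integrable_const _).sub (hint.const_mul 2)
    rw [integral_add h2 hsq, integral_sub (integrable_const _) (hint.const_mul 2),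
      integral_const_mul, hone]
    simp
    ring
  refine tvDist_le_of_forall _ _ fun A hA => ?_
  have hQ : (P.withDensity fun x => ENNReal.ofReal (f x)).real A = ∫ x in A, f x ∂P := by
    rw [measureReal_def, withDensity_apply _ hA,
      integral_eq_lintegral_of_nonneg_ae (ae_of_all _ h0) hf.aestronglyMeasurable.restrict]
  have hP : P.real A = ∫ x in A, (1 : ℝ) ∂P := by simp
  rw [hQ, hP, ← integral_sub (integrable_const _) hint.integrableOn]
  calc |∫ x in A, (1 - f x) ∂P| ≤ ∫ x in A, |1 - f x| ∂P := abs_integral_le_integral_abs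
    _ ≤ ∫ x, |1 - f x| ∂P :=
        setIntegral_le_integral hsub.abs (ae_of_all _ fun x => abs_nonneg _)
    _ ≤ √(∫ x, f x ^ 2 ∂P - 1) := by
        apply Real.le_sqrt_of_sq_le
        linarith

theorem pi_withDensity_ofReal {ι : Type*} [Fintype ι] (P : ι → Measure Ω)
    [∀ i, IsProbabilityMeasure (P i)] {f : ι → Ω → ℝ} (h0 : ∀ i x, 0 ≤ f i x)
    (hint : ∀ i, Integrable (f i) (P i)) :
    Measure.pi (fun i => (P i).withDensity fun x => ENNReal.ofReal (f i x)) =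
      (Measure.pi P).withDensity fun x => ENNReal.ofReal (∏ i, f i (x i)) := by
  have (i : ι) : IsFiniteMeasure ((P i).withDensity fun x => ENNReal.ofReal (f i x)) :=
    isFiniteMeasure_withDensity_ofReal (hint i).2
  refine Measure.pi_eq fun s hs => ?_
  rw [withDensity_apply _ (MeasurableSet.univ_pi hs), Measure.restrict_pi_pi,
    ← ofReal_integral_eq_lintegral_ofReal (Integrable.fintype_prod fun i => (hint i).restrict)
      (ae_of_all _ fun x => Finset.prod_nonneg fun i _ => h0 i _),
    integral_fintype_prod_eq_prod f,
    ENNReal.ofReal_prod_of_nonneg fun i _ => integral_nonneg (h0 i)]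
  refine Finset.prod_congr rfl fun i _ => ?_
  rw [withDensity_apply _ (hs i),
    ofReal_integral_eq_lintegral_ofReal (hint i).restrict (ae_of_all _ (h0 i))]

end TotalVariation

/-! ### Upper bound for products of centred Gaussians -/

section GaussianUpper

/-- The density of `N(0, v)` with respect to `N(0, 1)`. -/
noncomputable def gaussianRatio (v : ℝ≥0) (x : ℝ) : ℝ :=
  gaussianPDFReal 0 v x / gaussianPDFReal 0 1 x

theorem measurable_gaussianRatio (v : ℝ≥0) : Measurable (gaussianRatio v) :=
  (measurable_gaussianPDFReal 0 v).div (measurable_gaussianPDFReal 0 1)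

theorem gaussianRatio_nonneg (v : ℝ≥0) (x : ℝ) : 0 ≤ gaussianRatio v x :=
  div_nonneg (gaussianPDFReal_nonneg _ _ _) (gaussianPDFReal_nonneg _ _ _)

theorem gaussianReal_eq_withDensity_gaussianRatio {v : ℝ≥0} (hv : v ≠ 0) :
    gaussianReal 0 v =
      (gaussianReal 0 1).withDensity fun x => ENNReal.ofReal (gaussianRatio v x) := by
  rw [gaussianReal_of_var_ne_zero 0 hv, gaussianReal_of_var_ne_zero 0 one_ne_zero,
    ← withDensity_mul _ (measurable_gaussianPDF 0 1) (measurable_gaussianRatio v).ennreal_ofReal]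
  congr 1
  ext1 x
  have h1 := gaussianPDFReal_pos 0 1 x one_ne_zero
  rw [Pi.mul_apply, gaussianPDF, gaussianPDF, ← ENNReal.ofReal_mul h1.le, gaussianRatio,
    mul_div_cancel₀ _ h1.ne']

theorem integral_gaussianRatio {v : ℝ≥0} (hv : v ≠ 0) :
    ∫ x, gaussianRatio v x ∂(gaussianReal 0 1) = 1 := by
  rw [integral_gaussianReal_eq_integral_smul one_ne_zero,
    ← integral_gaussianPDFReal_eq_one 0 hv]
  refine integral_congr_ae (ae_of_all _ fun x => ?_)
  have h1 := gaussianPDFReal_pos 0 1 x one_ne_zero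
  simp only [gaussianRatio, smul_eq_mul]
  rw [mul_div_cancel₀ _ h1.ne']

theorem integrable_gaussianRatio {v : ℝ≥0} (hv : v ≠ 0) :
    Integrable (gaussianRatio v) (gaussianReal 0 1) := by
  -- The Bochner integral of a non-integrable function is 0, so the nonzero value already computed
  -- forces integrability.
  by_contra h
  have := integral_gaussianRatio hv
  rw [integral_undef h] at this
  exact zero_ne_one this

/-- The integrand is a constant times `exp(-(1/v - 1/2) x²)`; the Gaussian integral converges
exactly because `v < 2`. -/
theorem integral_gaussianRatio_sq {v : ℝ≥0} (hv : v ≠ 0) (hv2 : v < 2) :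
    ∫ x, gaussianRatio v x ^ 2 ∂(gaussianReal 0 1) = (√(v * (2 - v)))⁻¹ := by
  have hv0 : (0 : ℝ) < v := by positivity
  have hv2' : (v : ℝ) < 2 := by exact_mod_cast hv2
  have hb : (0 : ℝ) < 1 / v - 1 / 2 := by
    rw [sub_pos]
    exact one_div_lt_one_div_of_lt hv0 hv2'
  rw [integral_gaussianReal_eq_integral_smul one_ne_zero]
  have key : ∀ x : ℝ, gaussianPDFReal 0 1 x • gaussianRatio v x ^ 2 =
      (√(2 * Real.pi) / (2 * Real.pi * v)) * Real.exp (-(1 / v - 1 / 2) * x ^ 2) := fun x => by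
    have h1 : Real.exp (-(1 / (v : ℝ) - 1 / 2) * x ^ 2) =
        Real.exp (-(x - 0) ^ 2 / (2 * v)) ^ 2 / Real.exp (-(x - 0) ^ 2 / (2 * (1 : ℝ≥0))) := by
      rw [← Real.exp_nat_mul, ← Real.exp_sub]
      congr 1
      push_cast
      field_simp
      ring
    have h2 := Real.exp_pos (-(x - 0) ^ 2 / (2 * ((1 : ℝ≥0) : ℝ)))
    have h3 : √(2 * Real.pi * v) ^ 2 = 2 * Real.pi * v := Real.sq_sqrt (by positivity)
    have h4 : 0 < √(2 * Real.pi) := by positivity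
    have h5 : 0 < √(2 * Real.pi * v) := by positivity
    rw [h1]
    simp only [gaussianRatio, gaussianPDFReal, smul_eq_mul]
    simp only [NNReal.coe_one, mul_one] at h2 ⊢
    field_simp
    linarith [h3]
  simp_rw [key]
  rw [integral_const_mul, integral_gaussian]
  have hlhs : 0 ≤ √(2 * Real.pi) / (2 * Real.pi * v) * √(Real.pi / (1 / v - 1 / 2)) := by positivity
  have h2v : 0 < 2 - (v : ℝ) := by linarith
  rw [← sq_eq_sq₀ hlhs (by positivity), mul_pow, div_pow, Real.sq_sqrt (by positivity),
    Real.sq_sqrt (by positivity), inv_pow, Real.sq_sqrt (by positivity)]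
  have : 1 / (v : ℝ) - 1 / 2 = (2 - v) / (2 * v) := by field_simp
  rw [this]
  have := Real.pi_pos
  field_simp

theorem integrable_gaussianRatio_sq {v : ℝ≥0} (hv : v ≠ 0) (hv2 : v < 2) :
    Integrable (fun x => gaussianRatio v x ^ 2) (gaussianReal 0 1) := by
  by_contra h
  have := integral_gaussianRatio_sq hv hv2
  rw [integral_undef h] at this
  have hv0 : (0 : ℝ) < v := by positivity
  have hv2' : (0 : ℝ) < 2 - v := sub_pos.2 (by exact_mod_cast hv2)
  have : (0 : ℝ) < (√(v * (2 - v)))⁻¹ := by positivity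
  linarith

theorem one_sub_sum_le_prod_one_sub {ι : Type*} (s : Finset ι) {f : ι → ℝ}
    (h0 : ∀ i ∈ s, 0 ≤ f i) (h1 : ∀ i ∈ s, f i ≤ 1) :
    1 - ∑ i ∈ s, f i ≤ ∏ i ∈ s, (1 - f i) := by
  classical
  induction s using Finset.induction_on with
  | empty => simp
  | insert a s ha ih =>
    rw [Finset.sum_insert ha, Finset.prod_insert ha]
    have ih' := ih (fun i hi => h0 i (Finset.mem_insert_of_mem hi))
      (fun i hi => h1 i (Finset.mem_insert_of_mem hi))
    have a0 := h0 a (Finset.mem_insert_self a s)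
    have a1 := h1 a (Finset.mem_insert_self a s)
    have hs : 0 ≤ ∑ i ∈ s, f i := Finset.sum_nonneg fun i hi => h0 i (Finset.mem_insert_of_mem hi)
    nlinarith [mul_le_mul_of_nonneg_left ih' (sub_nonneg.2 a1)]

variable {ι : Type*} [Fintype ι]

theorem tvDist_pi_gaussianReal_le_sqrt {v : ι → ℝ≥0} (hv : ∀ i, v i ≠ 0) (hv2 : ∀ i, v i < 2) :
    tvDist (Measure.pi fun _ : ι => gaussianReal 0 1) (Measure.pi fun i => gaussianReal 0 (v i)) ≤
      √((√(∏ i, (1 - ((v i : ℝ) - 1) ^ 2)))⁻¹ - 1) := by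
  have hpi : (Measure.pi fun i => gaussianReal 0 (v i)) =
      (Measure.pi fun _ : ι => gaussianReal 0 1).withDensity
        fun x => ENNReal.ofReal (∏ i, gaussianRatio (v i) (x i)) := by
    rw [← pi_withDensity_ofReal (fun _ : ι => gaussianReal 0 1)
      (fun i => gaussianRatio_nonneg (v i)) fun i => integrable_gaussianRatio (hv i)]
    congr 1
    ext1 i
    exact gaussianReal_eq_withDensity_gaussianRatio (hv i)
  have hone : ∫ x : ι → ℝ, ∏ i, gaussianRatio (v i) (x i)
      ∂(Measure.pi fun _ : ι => gaussianReal 0 1) = 1 := by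
    rw [integral_fintype_prod_eq_prod]
    exact Finset.prod_eq_one fun i _ => integral_gaussianRatio (hv i)
  have hsq : ∫ x : ι → ℝ, (∏ i, gaussianRatio (v i) (x i)) ^ 2
      ∂(Measure.pi fun _ : ι => gaussianReal 0 1) =
      (√(∏ i, (1 - ((v i : ℝ) - 1) ^ 2)))⁻¹ := by
    simp_rw [← Finset.prod_pow]
    rw [integral_fintype_prod_eq_prod fun i x => gaussianRatio (v i) x ^ 2,
      Real.sqrt_eq_rpow, ← Real.finsetProd_rpow, ← Finset.prod_inv_distrib]
    · refine Finset.prod_congr rfl fun i _ => ?_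
      rw [integral_gaussianRatio_sq (hv i) (hv2 i), Real.sqrt_eq_rpow]
      congr 2
      ring
    · intro i _
      have h1 : (v i : ℝ) < 2 := by exact_mod_cast hv2 i
      nlinarith [(v i).coe_nonneg]
  rw [hpi, ← hsq]
  refine tvDist_withDensity_le_sqrt _ ?_ (fun x => Finset.prod_nonneg fun i _ =>
    gaussianRatio_nonneg _ _) (Integrable.fintype_prod fun i => integrable_gaussianRatio (hv i))
    hone ?_
  · exact Finset.measurable_prod _ fun i _ =>
      (measurable_gaussianRatio (v i)).comp (measurable_pi_apply i)
  · simp_rw [← Finset.prod_pow]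
    exact Integrable.fintype_prod (f := fun i x => gaussianRatio (v i) x ^ 2)
      fun i => integrable_gaussianRatio_sq (hv i) (hv2 i)

theorem tvDist_pi_gaussianReal_le {v : ι → ℝ≥0} (hv : ∀ i, v i ≠ 0) :
    tvDist (Measure.pi fun _ : ι => gaussianReal 0 1) (Measure.pi fun i => gaussianReal 0 (v i)) ≤
      3 / 2 * min 1 √(∑ i, ((v i : ℝ) - 1) ^ 2) := by
  set s := ∑ i, ((v i : ℝ) - 1) ^ 2 with hs
  have hs0 : 0 ≤ s := Finset.sum_nonneg fun i _ => sq_nonneg _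
  -- At `s = 4/9` the claimed bound `3/2 * √s` reaches 1. Below it every `|v i - 1| < 2/3`, so `v i
  -- < 2` and the χ² formula applies.
  rcases le_or_gt (4 / 9) s with h | h
  · refine (tvDist_le_one _ _).trans ?_
    have : (2 / 3 : ℝ) ≤ √s := Real.le_sqrt_of_sq_le (by norm_num; linarith)
    have : (2 / 3 : ℝ) ≤ min 1 √s := le_min (by norm_num) this
    linarith
  · have hi (i : ι) : ((v i : ℝ) - 1) ^ 2 ≤ s :=
      Finset.single_le_sum (f := fun i => ((v i : ℝ) - 1) ^ 2) (fun i _ => sq_nonneg _)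
        (Finset.mem_univ i)
    have hv2 (i : ι) : v i < 2 := by
      have : (v i : ℝ) < 2 := by nlinarith [hi i]
      exact_mod_cast this
    have hprod : 1 - s ≤ ∏ i, (1 - ((v i : ℝ) - 1) ^ 2) :=
      one_sub_sum_le_prod_one_sub _ (fun i _ => sq_nonneg _) fun i _ => by linarith [hi i]
    have hsqrt : 1 - s ≤ √(1 - s) := Real.le_sqrt_of_sq_le (by nlinarith)
    have hle : (√(∏ i, (1 - ((v i : ℝ) - 1) ^ 2)))⁻¹ ≤ (1 - s)⁻¹ :=
      inv_anti₀ (by linarith) (hsqrt.trans (Real.sqrt_le_sqrt hprod))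
    -- The left side is `s / (1 - s)`, and `1 / (1 - s) ≤ 9/4` as long as `s ≤ 5/9`.
    have hinv : (1 - s)⁻¹ - 1 ≤ (3 / 2) ^ 2 * s := by
      have : 0 < 1 - s := by linarith
      rw [inv_eq_one_div, div_sub_one this.ne', div_le_iff₀ this]
      nlinarith
    refine (tvDist_pi_gaussianReal_le_sqrt hv hv2).trans ?_
    have hmin : min 1 √s = √s := min_eq_right (Real.sqrt_le_one.2 (by linarith))
    rw [hmin]
    calc √((√(∏ i, (1 - ((v i : ℝ) - 1) ^ 2)))⁻¹ - 1) ≤ √((3 / 2) ^ 2 * s) :=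
          Real.sqrt_le_sqrt (by linarith)
      _ = 3 / 2 * √s := by rw [Real.sqrt_mul (by positivity), Real.sqrt_sq (by norm_num)]

end GaussianUpper

/-! ### Lower bound through characteristic functions of quadratic forms -/

section GaussianLower

/-- The left side is the distance from `exp u` to the real line spanned by `exp (i Im w)`, on which
`exp w` lies. Only the phase difference matters, so no control of `w.re` is needed. -/
theorem norm_sub_exp_ge (u w : ℂ) :
    Real.exp u.re * |Real.sin (w.im - u.im)| ≤ ‖Complex.exp u - Complex.exp w‖ := by
  have h1 : Complex.exp u - Complex.exp w =
      Complex.exp (u.re + w.im * Complex.I) *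
        (Complex.exp ((u.im - w.im : ℝ) * Complex.I) - (Real.exp (w.re - u.re) : ℝ)) := by
    rw [mul_sub, ← Complex.exp_add, Complex.ofReal_exp, ← Complex.exp_add]
    congr 2
    · apply Complex.ext <;> simp
    · apply Complex.ext <;> simp
  rw [h1, norm_mul, Complex.norm_exp]
  refine mul_le_mul (by simp) ?_ (abs_nonneg _) (Real.exp_pos _).le
  refine le_trans (le_of_eq ?_) (Complex.abs_im_le_norm _)
  rw [Complex.sub_im, Complex.exp_ofReal_mul_I_im, Complex.ofReal_im, sub_zero,
    ← abs_neg, ← Real.sin_neg, neg_sub]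

theorem one_sub_mul_I_ne_zero (x : ℝ) : (1 - x * Complex.I : ℂ) ≠ 0 := fun h => by
  have := congrArg Complex.re h
  simp at this

theorem norm_one_sub_mul_I (x : ℝ) : ‖(1 - x * Complex.I : ℂ)‖ = √(1 + x ^ 2) := by
  rw [Complex.norm_def, Complex.normSq_apply]
  simp
  ring_nf

theorem log_one_sub_mul_I_re (x : ℝ) :
    (Complex.log (1 - x * Complex.I)).re = Real.log (1 + x ^ 2) / 2 := by
  rw [Complex.log_re, norm_one_sub_mul_I, Real.log_sqrt (by positivity)]

theorem arg_one_sub_mul_I (x : ℝ) : (1 - x * Complex.I : ℂ).arg = -Real.arctan x := by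
  rw [Complex.arg_of_re_nonneg (by simp), norm_one_sub_mul_I, ← Real.arctan_neg,
    Real.arctan_eq_arcsin]
  simp

theorem log_one_sub_mul_I_im (x : ℝ) :
    (Complex.log (1 - x * Complex.I)).im = -Real.arctan x := by
  rw [Complex.log_im, arg_one_sub_mul_I]

/-- The characteristic function of the square of a centred Gaussian variable. -/
theorem integral_exp_mul_sq_mul_I_gaussianReal {v : ℝ≥0} (hv : v ≠ 0) (a : ℝ) :
    ∫ x : ℝ, Complex.exp ((a * x ^ 2 : ℝ) * Complex.I) ∂(gaussianReal 0 v) =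
      Complex.exp (-(Complex.log (1 - (2 * a * v : ℝ) * Complex.I) / 2)) := by
  have hv0 : (0 : ℝ) < v := by positivity
  have hvc : (v : ℂ) ≠ 0 := by exact_mod_cast hv0.ne'
  set w : ℂ := 1 - (2 * a * v : ℝ) * Complex.I with hw
  have hw0 : w ≠ 0 := one_sub_mul_I_ne_zero _
  -- `w` has real part 1, so it avoids the branch cut and `log w⁻¹ = -log w`.
  have hwarg : w.arg ≠ Real.pi := by
    rw [hw, arg_one_sub_mul_I]
    have := Real.neg_pi_div_two_lt_arctan (2 * a * v)
    have := Real.pi_pos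
    intro h
    linarith
  set b : ℂ := (((2 * v)⁻¹ : ℝ) : ℂ) * w with hb
  have hbre : 0 < b.re := by
    rw [hb, Complex.re_ofReal_mul, hw]
    simp
    positivity
  have key : ∀ x : ℝ, gaussianPDFReal 0 v x • Complex.exp ((a * x ^ 2 : ℝ) * Complex.I) =
      ((√(2 * Real.pi * v))⁻¹ : ℝ) * Complex.exp (-b * x ^ 2) := fun x => by
    rw [gaussianPDFReal, Complex.real_smul, Complex.ofReal_mul, mul_assoc, Complex.ofReal_exp,
      ← Complex.exp_add]
    congr 2
    rw [hb, hw]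
    push_cast
    field_simp
    ring
  rw [integral_gaussianReal_eq_integral_smul hv]
  simp_rw [key]
  have hpb : (Real.pi / b : ℂ) = ((2 * Real.pi * v : ℝ) : ℂ) * w⁻¹ := by
    rw [hb]
    push_cast
    field_simp
  have hpos : 0 < 2 * Real.pi * v := by positivity
  rw [integral_const_mul, integral_gaussian_complex hbre, hpb,
    Complex.cpow_def_of_ne_zero (mul_ne_zero (by exact_mod_cast hpos.ne') (inv_ne_zero hw0)),
    Complex.log_ofReal_mul hpos (inv_ne_zero hw0), Complex.log_inv _ hwarg, add_mul,
    Complex.exp_add, ← mul_assoc]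
  have hs : Complex.exp ((Real.log (2 * Real.pi * v) : ℝ) * (1 / 2)) =
      (√(2 * Real.pi * v) : ℝ) := by
    rw [← Real.exp_log (Real.sqrt_pos.2 hpos), Real.log_sqrt hpos.le]
    push_cast
    congr 1
    ring
  rw [hs, ← Complex.ofReal_mul, inv_mul_cancel₀ (Real.sqrt_pos.2 hpos).ne', Complex.ofReal_one,
    one_mul]
  congr 1
  ring

theorem arctan_sub_arctan_le {x y : ℝ} (h : x ≤ y) : Real.arctan y - Real.arctan x ≤ y - x := by
  have := Convex.image_sub_le_mul_sub_of_deriv_le (D := Set.univ) convex_univ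
    Real.continuous_arctan.continuousOn Real.differentiable_arctan.differentiableOn (C := 1)
    (fun z _ => by
      rw [Real.deriv_arctan]
      exact (div_le_one (by positivity)).2 (by nlinarith [sq_nonneg z])) x trivial y trivial h
  linarith

theorem half_sub_le_arctan_sub_arctan {x y : ℝ} (h : x ≤ y) (hx : -1 ≤ x) (hy : y ≤ 1) :
    (y - x) / 2 ≤ Real.arctan y - Real.arctan x := by
  have := Convex.mul_sub_le_image_sub_of_le_deriv (D := Set.Icc (-1 : ℝ) 1) (convex_Icc _ _)
    Real.continuous_arctan.continuousOn Real.differentiable_arctan.differentiableOn (C := 1 / 2)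
    (fun z hz => by
      rw [interior_Icc] at hz
      rw [Real.deriv_arctan]
      exact one_div_le_one_div_of_le (by positivity) (by nlinarith [hz.1, hz.2]))
    x ⟨hx, h.trans hy⟩ y ⟨hx.trans h, hy⟩ h
  linarith

variable {ι : Type*} [Fintype ι]

theorem integral_exp_sum_sq_mul_I_pi {v : ι → ℝ≥0} (hv : ∀ i, v i ≠ 0) (a : ι → ℝ) :
    ∫ x : ι → ℝ, ∏ i, Complex.exp ((a i * x i ^ 2 : ℝ) * Complex.I)
        ∂(Measure.pi fun i => gaussianReal 0 (v i)) =
      Complex.exp (∑ i, -(Complex.log (1 - (2 * a i * v i : ℝ) * Complex.I) / 2)) := by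
  rw [integral_fintype_prod_eq_prod fun i x => Complex.exp ((a i * x ^ 2 : ℝ) * Complex.I),
    Complex.exp_sum]
  exact Finset.prod_congr rfl fun i _ => integral_exp_mul_sq_mul_I_gaussianReal (hv i) (a i)

/-- `h1` keeps the modulus of the integral under `N(0, I)` near 1; together with `h2` it keeps the
arctangents in `[-1, 1]`, where their derivative is at least `1/2`. -/
theorem le_tvDist_pi_gaussianReal_of_scale {v : ι → ℝ≥0} (hv : ∀ i, v i ≠ 0) {t : ℝ}
    (ht : 0 ≤ t) (h1 : t * √(∑ i, ((v i : ℝ) - 1) ^ 2) ≤ 1 / 4)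
    (h2 : t * ∑ i, ((v i : ℝ) - 1) ^ 2 ≤ 1 / 4) :
    1 / 20 * (t * ∑ i, ((v i : ℝ) - 1) ^ 2) ≤
      tvDist (Measure.pi fun _ : ι => gaussianReal 0 1)
        (Measure.pi fun i => gaussianReal 0 (v i)) := by
  set s := ∑ i, ((v i : ℝ) - 1) ^ 2 with hs
  have hs0 : 0 ≤ s := Finset.sum_nonneg fun i _ => sq_nonneg _
  set a : ι → ℝ := fun i => t * ((v i : ℝ) - 1) with ha
  have hle (i : ι) : ((v i : ℝ) - 1) ^ 2 ≤ s :=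
    Finset.single_le_sum (f := fun i => ((v i : ℝ) - 1) ^ 2) (fun i _ => sq_nonneg _)
      (Finset.mem_univ i)
  have habs (i : ι) : |a i| ≤ 1 / 4 := by
    rw [ha, abs_mul, abs_of_nonneg ht]
    exact (mul_le_mul_of_nonneg_left (Real.abs_le_sqrt (hle i)) ht).trans h1
  have hsq (i : ι) : t * ((v i : ℝ) - 1) ^ 2 ≤ 1 / 4 :=
    (mul_le_mul_of_nonneg_left (hle i) ht).trans h2
  -- Taking `a i` proportional to `v i - 1` makes each phase increment nonnegative, so nothing
  -- cancels in the sum.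
  have hdiff (i : ι) : 2 * a i * v i - 2 * a i = 2 * (t * ((v i : ℝ) - 1) ^ 2) := by
    simp only [ha]; ring
  have hnn (i : ι) : 0 ≤ t * ((v i : ℝ) - 1) ^ 2 := mul_nonneg ht (sq_nonneg _)
  have htv := norm_integral_sub_le_four_mul_tvDist (Measure.pi fun _ : ι => gaussianReal 0 1)
    (Measure.pi fun i => gaussianReal 0 (v i))
    (f := fun x => ∏ i, Complex.exp ((a i * x i ^ 2 : ℝ) * Complex.I)) (by fun_prop)
    (fun x => by simp only [norm_prod, Complex.norm_exp_ofReal_mul_I, Finset.prod_const_one, le_refl])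
  have hP := integral_exp_sum_sq_mul_I_pi (v := fun _ : ι => 1) (fun _ => one_ne_zero) a
  rw [hP, integral_exp_sum_sq_mul_I_pi hv] at htv
  have hlow := (norm_sub_exp_ge _ _).trans htv
  set u : ℂ := ∑ i, -(Complex.log (1 - (2 * a i * (1 : ℝ≥0) : ℝ) * Complex.I) / 2) with hu
  set w : ℂ := ∑ i, -(Complex.log (1 - (2 * a i * v i : ℝ) * Complex.I) / 2) with hw
  have hure : -(1 / 16) ≤ u.re := by
    have : u.re = ∑ i, -(Real.log (1 + (2 * a i) ^ 2) / 4) := by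
      rw [hu, Complex.re_sum]
      refine Finset.sum_congr rfl fun i _ => ?_
      rw [Complex.neg_re, Complex.div_ofNat_re, log_one_sub_mul_I_re, NNReal.coe_one, mul_one]
      ring
    rw [this]
    have h3 : ∑ i, -(a i) ^ 2 = -(t * √s) ^ 2 := by
      rw [mul_pow, Real.sq_sqrt hs0, hs, Finset.mul_sum, ← Finset.sum_neg_distrib]
      exact Finset.sum_congr rfl fun i _ => by simp only [ha]; ring
    have h4 : -(1 / 16 : ℝ) ≤ ∑ i, -(a i) ^ 2 := by
      rw [h3]
      nlinarith [mul_nonneg ht (Real.sqrt_nonneg s)]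
    refine h4.trans (Finset.sum_le_sum fun i _ => ?_)
    have := Real.log_le_sub_one_of_pos (x := 1 + (2 * a i) ^ 2) (by positivity)
    nlinarith
  have him : w.im - u.im = ∑ i, (Real.arctan (2 * a i * v i) - Real.arctan (2 * a i)) / 2 := by
    rw [hu, hw, Complex.im_sum, Complex.im_sum, ← Finset.sum_sub_distrib]
    refine Finset.sum_congr rfl fun i _ => ?_
    rw [Complex.neg_im, Complex.div_ofNat_im, log_one_sub_mul_I_im, Complex.neg_im,
      Complex.div_ofNat_im, log_one_sub_mul_I_im, NNReal.coe_one, mul_one]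
    ring
  have him_le : w.im - u.im ≤ t * s := by
    rw [him, hs, Finset.mul_sum]
    refine Finset.sum_le_sum fun i _ => ?_
    have := arctan_sub_arctan_le (x := 2 * a i) (y := 2 * a i * v i)
      (by linarith [hdiff i, hnn i])
    linarith [hdiff i]
  have him_ge : t * s / 2 ≤ w.im - u.im := by
    rw [him, hs, Finset.mul_sum, Finset.sum_div]
    refine Finset.sum_le_sum fun i _ => ?_
    have h5 := abs_le.1 (habs i)
    have := half_sub_le_arctan_sub_arctan (x := 2 * a i) (y := 2 * a i * v i)
      (by linarith [hdiff i, hnn i]) (by linarith) (by linarith [hdiff i, hsq i])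
    linarith [hdiff i]
  have hts : 0 ≤ t * s := mul_nonneg ht hs0
  have hsin := Real.mul_le_sin (x := w.im - u.im) (by linarith) (by linarith [Real.pi_gt_three])
  have hpi : (1 / 2 : ℝ) ≤ 2 / Real.pi := by
    rw [div_le_div_iff₀ two_pos Real.pi_pos]
    linarith [Real.pi_le_four]
  have hsin' : t * s / 4 ≤ |Real.sin (w.im - u.im)| := by
    refine le_trans ?_ (le_abs_self _)
    nlinarith
  have hexp : 15 / 16 ≤ Real.exp u.re := by
    linarith [Real.add_one_le_exp u.re]
  -- With the factor 4 in `hlow`, TV is at least `(15/16) * (1/4) * (1/4) = 15/256 ≥ 1/20` times `t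
  -- * s`.
  have := mul_le_mul hexp hsin' (by linarith) (Real.exp_pos _).le
  linarith

theorem le_tvDist_pi_gaussianReal {v : ι → ℝ≥0} (hv : ∀ i, v i ≠ 0) :
    1 / 100 * min 1 √(∑ i, ((v i : ℝ) - 1) ^ 2) ≤
      tvDist (Measure.pi fun _ : ι => gaussianReal 0 1)
        (Measure.pi fun i => gaussianReal 0 (v i)) := by
  have hs0 : 0 ≤ ∑ i, ((v i : ℝ) - 1) ^ 2 := Finset.sum_nonneg fun i _ => sq_nonneg _
  have scale := fun t => le_tvDist_pi_gaussianReal_of_scale hv (t := t)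
  set s := ∑ i, ((v i : ℝ) - 1) ^ 2 with hs
  have hsq : √s ^ 2 = s := Real.sq_sqrt hs0
  rcases hs0.eq_or_lt with h | h
  · rw [← h]
    simpa using tvDist_nonneg _ _
  have hr : 0 < √s := Real.sqrt_pos.2 h
  -- The largest admissible `t` is `1 / (4√s)` when `√s ≤ 1` and `1 / (4s)` otherwise. Then `t * s`
  -- is `√s / 4` or `1/4`, giving the constant `1/80 ≥ 1/100`.
  rcases le_total √s 1 with h1 | h1
  · rw [min_eq_right h1]
    have e1 : 1 / (4 * √s) * √s = 1 / 4 := by field_simp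
    have e2 : 1 / (4 * √s) * s = √s / 4 := by
      rw [← hsq, Real.sqrt_sq hr.le]; field_simp
    have := scale (1 / (4 * √s)) (by positivity) e1.le (by rw [e2]; linarith)
    rw [e2] at this
    linarith
  · rw [min_eq_left h1]
    have e2 : 1 / (4 * s) * s = 1 / 4 := by field_simp
    have e1 : 1 / (4 * s) * √s ≤ 1 / 4 := by
      rw [← e2]
      exact mul_le_mul_of_nonneg_left (by nlinarith) (by positivity)
    have := scale (1 / (4 * s)) (by positivity) e1 e2.le
    rw [e2] at this
    linarith

end GaussianLower

/-! ### Affine images of multivariate Gaussians -/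

section MultivariateGaussian

open Matrix in
theorem multivariateGaussian_map {m n : Type*} [Fintype m] [Fintype n] [DecidableEq m]
    [DecidableEq n] {S : Matrix m m ℝ} (hS : S.PosSemidef) (μ : EuclideanSpace ℝ m)
    (ν : EuclideanSpace ℝ n) (M : Matrix n m ℝ) :
    (multivariateGaussian μ S).map (fun x => ν + WithLp.toLp 2 (M *ᵥ (x - μ).ofLp)) =
      multivariateGaussian ν (M * S * Mᵀ) := by
  have hMS : (M * S * Mᵀ).PosSemidef := by
    simpa using hS.mul_mul_conjTranspose_same M
  have hmeas : Measurable fun x : EuclideanSpace ℝ m =>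
      ν + WithLp.toLp 2 (M *ᵥ (x - μ).ofLp) := by
    refine Continuous.measurable ?_
    exact continuous_const.add ((PiLp.continuous_toLp 2 _).comp
      ((Continuous.matrix_mulVec continuous_const (PiLp.continuous_ofLp 2 _)).comp
        (continuous_id.sub continuous_const)))
  have := Measure.isProbabilityMeasure_map (μ := multivariateGaussian μ S) hmeas.aemeasurable
  apply Measure.ext_of_charFun
  ext1 t
  rw [charFun_multivariateGaussian hMS, charFun_apply,
    integral_map hmeas.aemeasurable (by fun_prop)]
  set y : EuclideanSpace ℝ m := WithLp.toLp 2 (Mᵀ *ᵥ t.ofLp) with hy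
  have hinner (x : EuclideanSpace ℝ m) :
      inner ℝ (ν + WithLp.toLp 2 (M *ᵥ (x - μ).ofLp)) t =
        inner ℝ x y + (inner ℝ t ν - inner ℝ y μ) := by
    have h1 : inner ℝ (WithLp.toLp 2 (M *ᵥ (x - μ).ofLp)) t = inner ℝ (x - μ) y := by
      simp only [EuclideanSpace.inner_eq_star_dotProduct, star_trivial, hy]
      rw [dotProduct_mulVec, mulVec_transpose]
    rw [inner_add_left, h1, inner_sub_left, real_inner_comm, real_inner_comm μ y]
    ring
  simp_rw [hinner, Complex.ofReal_add, add_mul, Complex.exp_add]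
  rw [integral_mul_const, ← charFun_apply, charFun_multivariateGaussian hS, ← Complex.exp_add]
  congr 1
  have h2 : (y.ofLp ⬝ᵥ S *ᵥ y.ofLp : ℝ) = t.ofLp ⬝ᵥ (M * S * Mᵀ) *ᵥ t.ofLp := by
    simp only [hy]
    rw [← mulVec_mulVec, ← mulVec_mulVec, dotProduct_mulVec t.ofLp M, mulVec_transpose]
  rw [h2]
  push_cast
  ring

theorem multivariateGaussian_zero_diagonal {ι : Type*} [Fintype ι] [DecidableEq ι] (v : ι → ℝ≥0) :
    multivariateGaussian 0 (Matrix.diagonal fun i => (v i : ℝ)) =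
      (Measure.pi fun i => gaussianReal 0 (v i)).map (WithLp.toLp 2) := by
  have hv : (Matrix.diagonal fun i => (v i : ℝ)).PosSemidef :=
    Matrix.PosSemidef.diagonal fun i => (v i).coe_nonneg
  have := Measure.isProbabilityMeasure_map (μ := Measure.pi fun i => gaussianReal 0 (v i))
    (f := WithLp.toLp 2) (by fun_prop)
  apply Measure.ext_of_charFun (E := EuclideanSpace ℝ ι)
  ext1 t
  simp_rw [charFun_multivariateGaussian hv, charFun_pi, charFun_gaussianReal, ← Complex.exp_sum]
  congr 1
  simp only [inner_zero_right, Complex.ofReal_zero, zero_mul, mul_zero, zero_sub, dotProduct,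
    Matrix.mulVec_diagonal, Finset.sum_neg_distrib]
  rw [Complex.ofReal_sum, Finset.sum_div]
  congr 1
  refine Finset.sum_congr rfl fun i _ => ?_
  push_cast
  ring

-- The affine map `x ↦ ν + M (x - μ)` carries the second pair to the first. It recentres as well, so
-- the two means are unrelated.
open Matrix in
theorem tvDist_multivariateGaussian_le_of_eq_mul {m n : Type*} [Fintype m] [Fintype n]
    [DecidableEq m] [DecidableEq n] {S₁ S₂ : Matrix m m ℝ} (h₁ : S₁.PosSemidef)
    (h₂ : S₂.PosSemidef) {T₁ T₂ : Matrix n n ℝ} (M : Matrix n m ℝ) (hT₁ : T₁ = M * S₁ * Mᵀ)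
    (hT₂ : T₂ = M * S₂ * Mᵀ) (μ : EuclideanSpace ℝ m) (ν : EuclideanSpace ℝ n) :
    tvDist (multivariateGaussian ν T₁) (multivariateGaussian ν T₂) ≤
      tvDist (multivariateGaussian μ S₁) (multivariateGaussian μ S₂) := by
  rw [hT₁, hT₂, ← multivariateGaussian_map h₁ μ, ← multivariateGaussian_map h₂ μ]
  refine tvDist_map_le _ _ (Continuous.measurable ?_)
  exact continuous_const.add ((PiLp.continuous_toLp 2 _).comp
      ((Continuous.matrix_mulVec continuous_const (PiLp.continuous_ofLp 2 _)).comp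
        (continuous_id.sub continuous_const)))

theorem tvDist_multivariateGaussian_diagonal {ι : Type*} [Fintype ι] [DecidableEq ι]
    (v : ι → ℝ≥0) :
    tvDist (multivariateGaussian 0 (1 : Matrix ι ι ℝ))
        (multivariateGaussian 0 (Matrix.diagonal fun i => (v i : ℝ))) =
      tvDist (Measure.pi fun _ : ι => gaussianReal 0 1)
        (Measure.pi fun i => gaussianReal 0 (v i)) := by
  have h1 : (1 : Matrix ι ι ℝ) = Matrix.diagonal fun _ => ((1 : ℝ≥0) : ℝ) := by simp
  rw [h1, multivariateGaussian_zero_diagonal, multivariateGaussian_zero_diagonal]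
  have hmeas : Measurable (WithLp.toLp 2 : (ι → ℝ) → EuclideanSpace ℝ ι) := by fun_prop
  have := Measure.isProbabilityMeasure_map (μ := Measure.pi fun _ : ι => gaussianReal 0 1)
    hmeas.aemeasurable
  have := Measure.isProbabilityMeasure_map (μ := Measure.pi fun i => gaussianReal 0 (v i))
    hmeas.aemeasurable
  refine le_antisymm (tvDist_map_le _ _ hmeas) ?_
  have hmeas' : Measurable (WithLp.ofLp : EuclideanSpace ℝ ι → ι → ℝ) := by fun_prop
  have hid : (WithLp.ofLp : EuclideanSpace ℝ ι → ι → ℝ) ∘ WithLp.toLp 2 = id := rfl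
  have := tvDist_map_le ((Measure.pi fun _ : ι => gaussianReal 0 1).map (WithLp.toLp 2))
    ((Measure.pi fun i => gaussianReal 0 (v i)).map (WithLp.toLp 2)) hmeas'
  rwa [Measure.map_map hmeas' hmeas, Measure.map_map hmeas' hmeas, hid, Measure.map_id,
    Measure.map_id] at this

end MultivariateGaussian

/-! ### Simultaneous diagonalization, eigenvalue lists, compression to the range -/

section LinearAlgebra

open Matrix

theorem Matrix.PosDef.exists_orthogonal_diagonalization {n : Type*} [Fintype n] [DecidableEq n]
    {A : Matrix n n ℝ} (hA : A.PosDef) :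
    ∃ (U : Matrix n n ℝ) (e : n → ℝ), U * Uᵀ = 1 ∧ (∀ i, 0 < e i) ∧ A = U * diagonal e * Uᵀ := by
  refine ⟨hA.isHermitian.eigenvectorUnitary, hA.isHermitian.eigenvalues, ?_,
    fun i => hA.eigenvalues_pos i, ?_⟩
  · have := Unitary.coe_mul_star_self hA.isHermitian.eigenvectorUnitary
    simpa [star_eq_conjTranspose] using this
  · have := hA.isHermitian.spectral_theorem
    rw [Unitary.conjStarAlgAut_apply] at this
    simpa [star_eq_conjTranspose] using this

/-- With `A = K Kᵀ` and `J = K⁻¹`, diagonalize `J B Jᵀ` by an orthogonal `W`; then `C = K W` serves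
both, since `W Wᵀ = 1` leaves `A` unaffected. -/
theorem Matrix.PosDef.exists_simultaneous_diagonalization {n : Type*} [Fintype n] [DecidableEq n]
    {A B : Matrix n n ℝ} (hA : A.PosDef) (hB : B.PosDef) :
    ∃ (C D : Matrix n n ℝ) (v : n → ℝ≥0), C * D = 1 ∧ (∀ i, v i ≠ 0) ∧ A = C * Cᵀ ∧
      B = C * diagonal (fun i => (v i : ℝ)) * Cᵀ := by
  obtain ⟨U, e, hU, he, rfl⟩ := hA.exists_orthogonal_diagonalization
  set K : Matrix n n ℝ := U * diagonal fun i => √(e i) with hK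
  set J : Matrix n n ℝ := (diagonal fun i => (√(e i))⁻¹) * Uᵀ with hJ
  have hKJ : K * J = 1 := by
    have : (diagonal fun i => √(e i)) * (diagonal fun i => (√(e i))⁻¹) = 1 := by
      rw [diagonal_mul_diagonal, ← diagonal_one]
      congr 1
      ext1 i
      exact mul_inv_cancel₀ (Real.sqrt_pos.2 (he i)).ne'
    rw [hK, hJ, Matrix.mul_assoc, ← Matrix.mul_assoc (diagonal _) (diagonal _), this,
      Matrix.one_mul, hU]
  have hJK : J * K = 1 := mul_eq_one_comm.1 hKJ
  have hKt : Jᵀ * Kᵀ = 1 := by rw [← transpose_mul, hKJ, transpose_one]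
  have hJB : (J * B * Jᵀ).PosDef := by
    have hinj : Function.Injective J.vecMul := fun x y hxy => by
      have := congrArg (fun z => z ᵥ* K) hxy
      simpa [vecMul_vecMul, hJK] using this
    simpa using hB.mul_mul_conjTranspose_same hinj
  obtain ⟨W, w, hW, hw, hBW⟩ := hJB.exists_orthogonal_diagonalization
  have hv (i : n) : (((w i).toNNReal : ℝ≥0) : ℝ) = w i := Real.coe_toNNReal _ (hw i).le
  refine ⟨K * W, Wᵀ * J, fun i => (w i).toNNReal, ?_, fun i => ?_, ?_, ?_⟩
  · rw [Matrix.mul_assoc, ← Matrix.mul_assoc W, hW, Matrix.one_mul, hKJ]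
  · exact (Real.toNNReal_pos.2 (hw i)).ne'
  · have hd : (diagonal fun i => √(e i)) * (diagonal fun i => √(e i)) = diagonal e := by
      rw [diagonal_mul_diagonal]
      congr 1
      ext1 i
      exact Real.mul_self_sqrt (he i).le
    rw [transpose_mul, Matrix.mul_assoc K, ← Matrix.mul_assoc W, hW, Matrix.one_mul, hK,
      transpose_mul, diagonal_transpose, ← hd]
    simp only [Matrix.mul_assoc]
  · simp_rw [hv]
    calc B = (K * J) * B * (Jᵀ * Kᵀ) := by rw [hKJ, hKt, Matrix.one_mul, Matrix.mul_one]
      _ = K * (J * B * Jᵀ) * Kᵀ := by simp only [Matrix.mul_assoc]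
      _ = K * W * diagonal w * (K * W)ᵀ := by
        rw [hBW, transpose_mul K W]; simp only [Matrix.mul_assoc]

theorem IsEigenvalueList.sum_sq_eq {n : ℕ} {A : Matrix (Fin n) (Fin n) ℝ} {k l : Fin n → ℝ}
    (hk : IsEigenvalueList A k) (hl : IsEigenvalueList A l) : ∑ i, k i ^ 2 = ∑ i, l i ^ 2 := by
  have roots (f : Fin n → ℝ) : (∏ i, (Polynomial.X - Polynomial.C (f i))).roots =
      Finset.univ.val.map f := by
    have := Polynomial.roots_multiset_prod_X_sub_C (Finset.univ.val.map f)
    rwa [Multiset.map_map] at this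
  have h : Finset.univ.val.map k = Finset.univ.val.map l := by
    rw [← roots, ← roots, ← hk, ← hl]
  have := congrArg (fun s => (s.map fun x => x ^ 2).sum) h
  rwa [Multiset.map_map, Multiset.map_map] at this

/-- `A⁻¹ B - 1` is the conjugate of `diagonal (v - 1)` by `Dᵀ = (Cᵀ)⁻¹`. -/
theorem isEigenvalueList_of_eq_mul {n : ℕ} {A B C D : Matrix (Fin n) (Fin n) ℝ} {v : Fin n → ℝ}
    (hCD : C * D = 1) (hA : A = C * Cᵀ) (hB : B = C * diagonal v * Cᵀ) :
    IsEigenvalueList (A⁻¹ * B - 1) fun i => v i - 1 := by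
  have hDC : D * C = 1 := mul_eq_one_comm.1 hCD
  have hDCt : Dᵀ * Cᵀ = 1 := by rw [← transpose_mul, hCD, transpose_one]
  have hAinv : A⁻¹ = Dᵀ * D := by
    refine inv_eq_left_inv ?_
    rw [hA, Matrix.mul_assoc, ← Matrix.mul_assoc D, hDC, Matrix.one_mul, hDCt]
  have hsub : A⁻¹ * B - 1 = Dᵀ * (diagonal (fun i => v i - 1) * Cᵀ) := by
    have hd : diagonal (fun i => v i - 1) = diagonal v - 1 := by
      rw [← diagonal_one, diagonal_sub]
    rw [hd, Matrix.sub_mul, Matrix.mul_sub, Matrix.one_mul, hDCt, hAinv, hB, Matrix.mul_assoc,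
      Matrix.mul_assoc C, ← Matrix.mul_assoc D, hDC, Matrix.one_mul]
  have hCDt : Cᵀ * Dᵀ = 1 := mul_eq_one_comm.1 hDCt
  rw [IsEigenvalueList, hsub, charpoly_mul_comm, Matrix.mul_assoc, hCDt, Matrix.mul_one,
    charpoly_diagonal]

/-- If the form vanishes at `x`, then `S Q x = 0`; but `Q x = S y` for some `y`, so `|Q x|² = yᵀ S Q
x = 0`. -/
theorem Matrix.PosSemidef.posDef_transpose_mul_mul {m n : Type*} [Fintype m] [Fintype n]
    [DecidableEq m] {S : Matrix m m ℝ} (hS : S.PosSemidef) {Q : Matrix m n ℝ}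
    (hQ : Function.Injective Q.mulVec)
    (hrange : LinearMap.range Q.mulVecLin ≤ LinearMap.range S.mulVecLin) :
    (Qᵀ * S * Q).PosDef := by
  have hSt : Sᵀ = S := by simpa using hS.isHermitian.eq
  have hpsd : (Qᵀ * S * Q).PosSemidef := by simpa using hS.conjTranspose_mul_mul_same Q
  refine PosDef.of_dotProduct_mulVec_pos hpsd.isHermitian fun x hx => ?_
  refine lt_of_le_of_ne (hpsd.dotProduct_mulVec_nonneg x) fun h => hx ?_
  have h1 : star (Q *ᵥ x) ⬝ᵥ S *ᵥ (Q *ᵥ x) = 0 := by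
    rw [h, star_trivial, star_trivial, ← mulVec_mulVec, ← mulVec_mulVec,
      dotProduct_mulVec x Qᵀ, vecMul_transpose]
  have h2 := (hS.dotProduct_mulVec_zero_iff _).1 h1
  obtain ⟨y, hy⟩ := hrange (LinearMap.mem_range_self Q.mulVecLin x)
  simp only [mulVecLin_apply] at hy
  have h3 : Q *ᵥ x = 0 := by
    rw [← dotProduct_self_eq_zero]
    nth_rw 1 [← hy]
    rw [dotProduct_comm, dotProduct_mulVec, ← mulVec_transpose, hSt, h2, zero_dotProduct]
  exact hQ (by rw [h3, mulVec_zero])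

theorem Matrix.exists_eq_mul_of_range_le {m n k : Type*} [Fintype n] [Fintype k] [DecidableEq k]
    {S : Matrix m k ℝ} {Q : Matrix m n ℝ}
    (h : LinearMap.range S.mulVecLin ≤ LinearMap.range Q.mulVecLin) :
    ∃ W : Matrix n k ℝ, S = Q * W := by
  choose w hw using fun j => h (LinearMap.mem_range_self S.mulVecLin (Pi.single j 1))
  refine ⟨of fun i j => w j i, ?_⟩
  ext i j
  have := congrFun (hw j) i
  simp only [mulVecLin_apply, mulVec_single_one, col_apply] at this
  rw [← this]
  rfl

theorem Matrix.mulVec_injective_of_rank_eq {m : Type*} [Fintype m] {r : ℕ}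
    {Q : Matrix m (Fin r) ℝ} (h : Q.rank = r) : Function.Injective Q.mulVec := by
  have hker := LinearMap.finrank_range_add_finrank_ker Q.mulVecLin
  rw [Module.finrank_fin_fun, ← Matrix.rank, h, Nat.add_eq_left,
    Submodule.finrank_eq_zero] at hker
  exact LinearMap.ker_eq_bot.1 hker

/-- A positive semidefinite matrix is fixed by conjugation with the orthogonal projection onto
its range. -/
theorem Matrix.PosSemidef.eq_projection_mul_mul {m n : Type*} [Fintype m] [Fintype n]
    [DecidableEq m] {S : Matrix m m ℝ} (hS : S.PosSemidef) {Q : Matrix m n ℝ} {G : Matrix n n ℝ}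
    (hrange : LinearMap.range S.mulVecLin ≤ LinearMap.range Q.mulVecLin) (hGt : Gᵀ = G)
    (hG : Q * G * (Qᵀ * Q) = Q) :
    Q * G * (Qᵀ * S * Q) * (Q * G)ᵀ = S := by
  have hSt : Sᵀ = S := by simpa using hS.isHermitian.eq
  obtain ⟨W, hW⟩ := exists_eq_mul_of_range_le hrange
  -- `Q G Qᵀ` fixes the columns of `Q`, hence also those of `S = Q W`.
  have h1 : Q * G * Qᵀ * S = S := by
    rw [hW, ← Matrix.mul_assoc, Matrix.mul_assoc (Q * G), hG]
  have h2 : S * (Q * G * Qᵀ) = S := by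
    have := congrArg (fun M => Mᵀ) h1
    simpa [transpose_mul, hSt, hGt, Matrix.mul_assoc] using this
  calc Q * G * (Qᵀ * S * Q) * (Q * G)ᵀ = Q * G * Qᵀ * S * (Q * G * Qᵀ) := by
        rw [transpose_mul, hGt]; simp only [Matrix.mul_assoc]
    _ = S := by rw [h1, h2]

end LinearAlgebra

/-! ### Reduction to the diagonal case, and the theorem -/

open Matrix in
theorem tvDist_multivariateGaussian_of_range_eq {d r : ℕ} (μ : EuclideanSpace ℝ (Fin d))
    {S₁ S₂ : Matrix (Fin d) (Fin d) ℝ} (h₁ : S₁.PosSemidef) (h₂ : S₂.PosSemidef)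
    (hrange : LinearMap.range S₁.mulVecLin = LinearMap.range S₂.mulVecLin) (hr : S₁.rank = r)
    {Q : Matrix (Fin d) (Fin r) ℝ}
    (hQ : LinearMap.range Q.mulVecLin = LinearMap.range S₁.mulVecLin) :
    IsUnit (Qᵀ * S₁ * Q) ∧
      (∃ ρ : Fin r → ℝ, IsEigenvalueList ((Qᵀ * S₁ * Q)⁻¹ * (Qᵀ * S₂ * Q) - 1) ρ) ∧
      ∀ ρ : Fin r → ℝ, IsEigenvalueList ((Qᵀ * S₁ * Q)⁻¹ * (Qᵀ * S₂ * Q) - 1) ρ →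
        1 / 100 * min 1 √(∑ i, ρ i ^ 2) ≤
          tvDist (multivariateGaussian μ S₁) (multivariateGaussian μ S₂) ∧
        tvDist (multivariateGaussian μ S₁) (multivariateGaussian μ S₂) ≤
          3 / 2 * min 1 √(∑ i, ρ i ^ 2) := by
  have hinj : Function.Injective Q.mulVec :=
    mulVec_injective_of_rank_eq (by rw [Matrix.rank, hQ]; exact hr)
  have hA := h₁.posDef_transpose_mul_mul hinj hQ.le
  have hB := h₂.posDef_transpose_mul_mul hinj (hQ.trans hrange).le
  obtain ⟨C, D, v, hCD, hv, hAC, hBC⟩ := hA.exists_simultaneous_diagonalization hB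
  have heig := isEigenvalueList_of_eq_mul hCD hAC hBC
  refine ⟨hA.isUnit, ⟨_, heig⟩, fun ρ hρ => ?_⟩
  rw [hρ.sum_sq_eq heig]
  have hDC : D * C = 1 := mul_eq_one_comm.1 hCD
  have hCDt : Cᵀ * Dᵀ = 1 := by rw [← transpose_mul, hDC, transpose_one]
  have hQQ : (Qᵀ * Q).PosDef := by simpa using PosDef.conjTranspose_mul_self Q hinj
  set G := (Qᵀ * Q)⁻¹ with hG
  have hGt : Gᵀ = G := by simpa using hQQ.inv.isHermitian.eq
  have hGQ : Q * G * (Qᵀ * Q) = Q := by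
    rw [Matrix.mul_assoc, hG, nonsing_inv_mul _ ((isUnit_iff_isUnit_det _).1 hQQ.isUnit),
      Matrix.mul_one]
  have hS₁ := h₁.eq_projection_mul_mul hQ.ge hGt hGQ
  have hS₂ := h₂.eq_projection_mul_mul (hQ.trans hrange).ge hGt hGQ
  have htv : tvDist (multivariateGaussian μ S₁) (multivariateGaussian μ S₂) =
      tvDist (Measure.pi fun _ : Fin r => gaussianReal 0 1)
        (Measure.pi fun i => gaussianReal 0 (v i)) := by
    rw [← tvDist_multivariateGaussian_diagonal]
    -- `Q G C` carries the standard pair to the given one, and `D Qᵀ` carries it back, so the two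
    -- distances agree although neither matrix need be square.
    refine le_antisymm ?_ ?_
    · refine tvDist_multivariateGaussian_le_of_eq_mul PosSemidef.one
        (PosSemidef.diagonal fun i => (v i).coe_nonneg) (Q * G * C) ?_ ?_ 0 μ
      · rw [← hS₁, hAC, transpose_mul (Q * G) C]
        simp only [Matrix.mul_assoc, Matrix.one_mul]
      · rw [← hS₂, hBC, transpose_mul (Q * G) C]
        simp only [Matrix.mul_assoc]
    · refine tvDist_multivariateGaussian_le_of_eq_mul h₁ h₂ (D * Qᵀ) ?_ ?_ μ 0
      · calc (1 : Matrix (Fin r) (Fin r) ℝ) = D * (C * Cᵀ) * Dᵀ := by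
              rw [← Matrix.mul_assoc, hDC, Matrix.one_mul, hCDt]
          _ = D * Qᵀ * S₁ * (D * Qᵀ)ᵀ := by
              rw [← hAC, transpose_mul, transpose_transpose]; simp only [Matrix.mul_assoc]
      · calc diagonal (fun i => (v i : ℝ)) = D * (C * diagonal (fun i => (v i : ℝ)) * Cᵀ) * Dᵀ := by
              rw [Matrix.mul_assoc C, ← Matrix.mul_assoc D, hDC, Matrix.one_mul, Matrix.mul_assoc,
                hCDt, Matrix.mul_one]
          _ = D * Qᵀ * S₂ * (D * Qᵀ)ᵀ := by
              rw [← hBC, transpose_mul, transpose_transpose]; simp only [Matrix.mul_assoc]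
  rw [htv]
  exact ⟨le_tvDist_pi_gaussianReal hv, tvDist_pi_gaussianReal_le hv⟩

end

theorem theorem1 {d : ℕ} (μ : EuclideanSpace ℝ (Fin d)) :
    -- the positive definite case
    (∀ S₁ S₂ : Matrix (Fin d) (Fin d) ℝ, S₁.PosDef → S₂.PosDef →
      (∃ l : Fin d → ℝ, IsEigenvalueList (S₁⁻¹ * S₂ - 1) l) ∧
      ∀ l : Fin d → ℝ, IsEigenvalueList (S₁⁻¹ * S₂ - 1) l →
        (1 / 100 : ℝ) * min 1 (Real.sqrt (∑ i, l i ^ 2)) ≤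
          tvDist (ProbabilityTheory.multivariateGaussian μ S₁)
            (ProbabilityTheory.multivariateGaussian μ S₂) ∧
        tvDist (ProbabilityTheory.multivariateGaussian μ S₁)
            (ProbabilityTheory.multivariateGaussian μ S₂) ≤
          (3 / 2 : ℝ) * min 1 (Real.sqrt (∑ i, l i ^ 2))) ∧
    -- the positive semidefinite case with equal ranges
    (∀ S₁ S₂ : Matrix (Fin d) (Fin d) ℝ, S₁.PosSemidef → S₂.PosSemidef →
      LinearMap.range S₁.mulVecLin = LinearMap.range S₂.mulVecLin →
      ∀ r : ℕ, S₁.rank = r →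
      ∀ Q : Matrix (Fin d) (Fin r) ℝ,
        LinearMap.range Q.mulVecLin = LinearMap.range S₁.mulVecLin →
        IsUnit (Q.transpose * S₁ * Q) ∧
        (∃ ρ : Fin r → ℝ, IsEigenvalueList
          ((Q.transpose * S₁ * Q)⁻¹ * (Q.transpose * S₂ * Q) - 1) ρ) ∧
        ∀ ρ : Fin r → ℝ, IsEigenvalueList
          ((Q.transpose * S₁ * Q)⁻¹ * (Q.transpose * S₂ * Q) - 1) ρ →
          (1 / 100 : ℝ) * min 1 (Real.sqrt (∑ i, ρ i ^ 2)) ≤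
            tvDist (ProbabilityTheory.multivariateGaussian μ S₁)
              (ProbabilityTheory.multivariateGaussian μ S₂) ∧
          tvDist (ProbabilityTheory.multivariateGaussian μ S₁)
              (ProbabilityTheory.multivariateGaussian μ S₂) ≤
            (3 / 2 : ℝ) * min 1 (Real.sqrt (∑ i, ρ i ^ 2))) := by
  refine ⟨fun S₁ S₂ h₁ h₂ => ?_, fun S₁ S₂ h₁ h₂ hrange r hr Q hQ =>
    tvDist_multivariateGaussian_of_range_eq μ h₁ h₂ hrange hr hQ⟩
  have htop {S : Matrix (Fin d) (Fin d) ℝ} (hS : IsUnit S) :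
      LinearMap.range S.mulVecLin = ⊤ :=
    LinearMap.range_eq_top.2 (Matrix.mulVec_surjective_iff_isUnit.2 hS)
  -- The positive definite case is the semidefinite one with full range and `Q = 1`.
  have h := (tvDist_multivariateGaussian_of_range_eq μ h₁.posSemidef h₂.posSemidef
    (by rw [htop h₁.isUnit, htop h₂.isUnit])
    (by rw [Matrix.rank_of_isUnit _ h₁.isUnit, Fintype.card_fin])
    (Q := 1) (by rw [htop h₁.isUnit, htop isUnit_one])).2
  simpa only [Matrix.transpose_one, Matrix.one_mul, Matrix.mul_one] using h
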